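/- Let $\Omega$ be an arbitrary topological space, let $S\subset\Omega$ be a nonempty subset with the subspace topology, and let $X\neq\{0\}$ be a Fréchet space, i.e. a locally convex topological vector space that is metrizable (hence Hausdorff) and complete. Call $S$ \emph{$C^*$-embedded} in $\Omega$ if every bounded continuous function $S\to\mathbb{R}$ extends to a bounded continuous function $\Omega\to\mathbb{R}$. Then $S$ is $C^*$-embedded in $\Omega$ if and only if for every continuous $f:S\to X$ whose range $f(S)$ is relatively compact (i.e. $\overline{f(S)}$ is compact) there is a continuous $g:\Omega\to X$ such that $g|_S=f$ and $g(\Omega)\subset \mathrm{co}\,\overline{f(S)}$, the convex hull of the closure of $f(S)$. Moreover, a subset of $X$ is relatively compact if and only if it is totally bounded. -/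

import Mathlib

open scoped BoundedContinuousFunction

/-- A subset `S` of a topological space `Ω` is `C*`-embedded if every bounded continuous
real function on `S` (with the subspace topology) extends to a bounded continuous real
function on `Ω`. -/
def IsCStarEmbedded {Ω : Type*} [TopologicalSpace Ω] (S : Set Ω) : Prop :=
  ∀ φ : S →ᵇ ℝ, ∃ ψ : Ω →ᵇ ℝ, ∀ s : S, ψ s = φ s

/-- A subset of a topological space is relatively compact if its closure is compact. -/
def IsRelativelyCompact {X : Type*} [TopologicalSpace X] (B : Set X) : Prop :=
  IsCompact (closure B)

open Set Topology Filter

/-! The compact metrizable set `K = closure (range f)` embeds as a closed subset of `ℕ → ℝ`. Each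
coordinate of `f` is bounded, so it extends to `Ω`; composing with a Dugundji extension of the
inverse embedding `e(K) → X` keeps values in the hull of `K`. Conversely, extend `φ • x` and apply a
functional `l` with `l x = 1`. -/

/-- **Dugundji's extension theorem**: a continuous map from a nonempty closed subset of a metric
space to a locally convex space extends to the whole space, with values in the convex hull of the
original range. -/
theorem exists_continuous_extension_range_subset_convexHull {Q E : Type*} [PseudoMetricSpace Q]
    [AddCommGroup E] [Module ℝ E] [TopologicalSpace E] [ContinuousAdd E] [ContinuousSMul ℝ E]
    [LocallyConvexSpace ℝ E] {A : Set Q} (hA : IsClosed A) (hne : A.Nonempty) (f : C(A, E)) :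
    ∃ g : C(Q, E), (∀ a : A, g a = f a) ∧ range g ⊆ convexHull ℝ (range f) := by
  classical
  have hpos : ∀ x : ↥Aᶜ, 0 < Metric.infDist (x : Q) A := fun x =>
    (hA.notMem_iff_infDist_pos hne).1 x.2
  let U : ↥Aᶜ → Set ↥Aᶜ := fun x => Metric.ball x (Metric.infDist (x : Q) A / 4)
  obtain ⟨ρ, hρ⟩ := PartitionOfUnity.exists_isSubordinate (isClosed_univ (X := ↥Aᶜ)) U
    (fun x => Metric.isOpen_ball)
    (fun x _ => mem_iUnion.2 ⟨x, Metric.mem_ball_self (by have := hpos x; positivity)⟩)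
  have hnear : ∀ x : ↥Aᶜ, ∃ a : A, dist (x : Q) a < 2 * Metric.infDist (x : Q) A := by
    intro x
    obtain ⟨a, ha, h⟩ := (Metric.infDist_lt_iff (s := A) (x := (x : Q))
      (r := 2 * Metric.infDist (x : Q) A) hne).1 (by linarith [hpos x])
    exact ⟨⟨a, ha⟩, h⟩
  choose a ha using hnear
  let h : ↥Aᶜ → E := fun y => ∑ᶠ x, ρ x y • f (a x)
  have hcont : Continuous h := by
    refine ρ.continuous_finsum_smul (g := fun x _ => f (a x)) fun x y _ => continuousAt_const
  have hmem : ∀ (y : ↥Aᶜ) (t : Set E), Convex ℝ t → (∀ x, ρ x y ≠ 0 → f (a x) ∈ t) → h y ∈ t :=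
    fun y t ht H => ρ.finsum_smul_mem_convex (g := fun x _ => f (a x)) (mem_univ y) H ht
  let g : Q → E := fun q => if hq : q ∈ A then f ⟨q, hq⟩ else h ⟨q, hq⟩
  have hgA : ∀ q (hq : q ∈ A), g q = f ⟨q, hq⟩ := fun q hq => dif_pos hq
  have hgC : ∀ q (hq : q ∉ A), g q = h ⟨q, hq⟩ := fun q hq => dif_neg hq
  have hg : Continuous g := by
    rw [continuous_iff_continuousAt]
    intro q
    by_cases hq : q ∈ A
    · rw [ContinuousAt, hgA q hq, (LocallyConvexSpace.convex_basis (𝕜 := ℝ) _).tendsto_right_iff]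
      rintro W ⟨hW, hWc⟩
      obtain ⟨δ, hδ, hδW⟩ := Metric.mem_nhds_iff.1 (f.continuous.continuousAt.preimage_mem_nhds hW)
      filter_upwards [Metric.ball_mem_nhds q (show 0 < δ / 6 by positivity)] with y hy
      rw [Metric.mem_ball] at hy
      by_cases hyA : y ∈ A
      · rw [hgA y hyA]
        exact hδW (show dist y q < δ by linarith)
      · rw [hgC y hyA]
        -- With `d = infDist x A ≤ dist x q`, `dist y x < d / 4` gives `dist x q < (4/3) dist y q`,
        -- so `dist (a x) q < 3 dist x q < 4 dist y q < δ`.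
        refine hmem _ W hWc fun x hx => hδW ?_
        have h1 : dist y x < Metric.infDist (x : Q) A / 4 :=
          hρ x (subset_tsupport _ hx)
        have h2 : Metric.infDist (x : Q) A ≤ dist (x : Q) q := Metric.infDist_le_dist_of_mem hq
        have h3 := dist_triangle (x : Q) y q
        have h4 := ha x
        have h5 := dist_triangle ((a x : A) : Q) x q
        rw [dist_comm (x : Q) y] at h3
        rw [dist_comm ((a x : A) : Q) x] at h5
        change dist ((a x : A) : Q) q < δ
        linarith
    · have : ContinuousOn g Aᶜ := by
        rw [continuousOn_iff_continuous_domRestrict]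
        convert hcont using 1
        ext y
        exact hgC y y.2
      exact this.continuousAt (hA.isOpen_compl.mem_nhds hq)
  refine ⟨⟨g, hg⟩, fun x => hgA x x.2, ?_⟩
  rintro _ ⟨q, rfl⟩
  change g q ∈ _
  by_cases hq : q ∈ A
  · rw [hgA q hq]
    exact subset_convexHull ℝ _ (mem_range_self _)
  · rw [hgC q hq]
    exact hmem _ _ (convex_convexHull ℝ _) fun x _ => subset_convexHull ℝ _ (mem_range_self _)

/-- A compact metrizable space embeds as a closed subspace of `ℕ → ℝ`. -/
theorem exists_isClosedEmbedding_pi_real (K : Type*) [TopologicalSpace K] [CompactSpace K]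
    [TopologicalSpace.MetrizableSpace K] [Nonempty K] :
    ∃ e : K → ℕ → ℝ, IsClosedEmbedding e := by
  let := TopologicalSpace.metrizableSpaceMetric K
  refine ⟨fun x n => dist (TopologicalSpace.denseSeq K n) x,
    Continuous.isClosedEmbedding (by fun_prop) fun x y hxy => ?_⟩
  -- Distance functions agreeing on a dense sequence agree everywhere, in particular at `y`.
  have : (fun z => dist z x) = fun z => dist z y :=
    (TopologicalSpace.denseRange_denseSeq K).equalizer (by fun_prop) (by fun_prop) hxy
  simpa using congrFun this y |>.trans (dist_self y) |> dist_eq_zero.1 |>.symm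

namespace IsCStarEmbedded

variable {Ω : Type*} [TopologicalSpace Ω] {S : Set Ω}

theorem exists_extension_real (hS : IsCStarEmbedded S) {K : Type*} [TopologicalSpace K]
    [CompactSpace K] (f : C(S, K)) (u : C(K, ℝ)) :
    ∃ F : C(Ω, ℝ), ∀ s : S, F s = u (f s) := by
  obtain ⟨ψ, hψ⟩ := hS ((BoundedContinuousFunction.mkOfCompact u).compContinuous f)
  exact ⟨ψ.toContinuousMap, hψ⟩

theorem exists_extension_convexHull (hS : IsCStarEmbedded S) (hne : S.Nonempty) {X : Type*}
    [AddCommGroup X] [Module ℝ X] [TopologicalSpace X] [ContinuousAdd X] [ContinuousSMul ℝ X]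
    [LocallyConvexSpace ℝ X] [TopologicalSpace.MetrizableSpace X]
    (f : C(S, X)) (hf : IsRelativelyCompact (range f)) :
    ∃ g : C(Ω, X), (∀ s : S, g s = f s) ∧ range g ⊆ convexHull ℝ (closure (range f)) := by
  let K : Set X := closure (range f)
  have : CompactSpace K := isCompact_iff_compactSpace.1 hf
  let f' : C(S, K) := ⟨fun s => ⟨f s, subset_closure (mem_range_self s)⟩, by fun_prop⟩
  have : Nonempty K := ⟨f' ⟨_, hne.some_mem⟩⟩
  obtain ⟨e, he⟩ := exists_isClosedEmbedding_pi_real K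
  choose F hF using fun n : ℕ =>
    hS.exists_extension_real f' ⟨fun k => e k n, (continuous_apply n).comp he.continuous⟩
  let : PseudoMetricSpace (ℕ → ℝ) := TopologicalSpace.pseudoMetrizableSpacePseudoMetric _
  let φ : K ≃ₜ range e := he.isEmbedding.toHomeomorph
  obtain ⟨g, hg, hgr⟩ := exists_continuous_extension_range_subset_convexHull he.isClosed_range
    (range_nonempty e) ⟨fun q => (φ.symm q : X), by fun_prop⟩
  refine ⟨⟨fun ω => g fun n => F n ω, by fun_prop⟩, fun s => ?_, ?_⟩
  · have h1 : (fun n => F n s) = (φ (f' s) : ℕ → ℝ) := funext fun n => hF n s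
    change g (fun n => F n s) = f s
    rw [h1, hg]
    simp [f']
  · rintro _ ⟨ω, rfl⟩
    refine convexHull_mono ?_ (hgr (mem_range_self _))
    rintro _ ⟨q, rfl⟩
    exact (φ.symm q).2

theorem of_exists_extension_convexHull {X : Type*} [AddCommGroup X] [Module ℝ X]
    [TopologicalSpace X] [IsTopologicalAddGroup X] [ContinuousSMul ℝ X] [LocallyConvexSpace ℝ X]
    [T2Space X] [Nontrivial X]
    (H : ∀ f : C(S, X), IsRelativelyCompact (range f) →
      ∃ g : C(Ω, X), (∀ s : S, g s = f s) ∧ range g ⊆ convexHull ℝ (closure (range f))) :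
    IsCStarEmbedded S := by
  intro φ
  obtain ⟨x, hx⟩ := exists_ne (0 : X)
  obtain ⟨l, hl⟩ := SeparatingDual.exists_eq_one (R := ℝ) hx
  -- This compact convex segment makes the range relatively compact and also confines `g`, so `l ∘
  -- g` is bounded by `‖φ‖`.
  let J : Set X := (fun r : ℝ => r • x) '' Icc (-‖φ‖) ‖φ‖
  have hJ : IsCompact J := isCompact_Icc.image (by fun_prop)
  have hJc : Convex ℝ J := (convex_Icc _ _).linear_image (LinearMap.toSpanSingleton ℝ X x)
  have hsub : closure (range fun s => φ s • x) ⊆ J := by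
    refine closure_minimal ?_ hJ.isClosed
    rintro _ ⟨s, rfl⟩
    exact ⟨φ s, abs_le.1 (φ.norm_coe_le_norm s), rfl⟩
  obtain ⟨g, hg, hgr⟩ := H ⟨fun s => φ s • x, by fun_prop⟩
    (hJ.of_isClosed_subset isClosed_closure hsub)
  refine ⟨BoundedContinuousFunction.ofNormedAddCommGroup (fun ω => l (g ω)) (by fun_prop) ‖φ‖
    fun ω => ?_, fun s => ?_⟩
  · obtain ⟨r, hr, hrg⟩ := convexHull_min hsub hJc (hgr (mem_range_self ω))
    rw [← hrg]
    simpa [hl] using abs_le.2 hr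
  · simp [hg, hl]

end IsCStarEmbedded

theorem isRelativelyCompact_iff_totallyBounded {X : Type*} [UniformSpace X] [CompleteSpace X]
    (B : Set X) : IsRelativelyCompact B ↔ TotallyBounded B :=
  ⟨fun h => h.totallyBounded.subset subset_closure,
    fun h => h.closure.isCompact_of_isClosed isClosed_closure⟩

/-- `X` is a Fréchet space: a locally convex, metrizable and complete topological vector space. -/
theorem mainTheorem6 {Ω : Type*} [TopologicalSpace Ω] (S : Set Ω) (hS : S.Nonempty)
    {X : Type*} [AddCommGroup X] [Module ℝ X] [UniformSpace X] [IsUniformAddGroup X]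
    [ContinuousSMul ℝ X] [LocallyConvexSpace ℝ X] [TopologicalSpace.MetrizableSpace X]
    [CompleteSpace X] [Nontrivial X] :
    (IsCStarEmbedded S ↔
      ∀ f : C(S, X), IsRelativelyCompact (Set.range f) →
        ∃ g : C(Ω, X), (∀ s : S, g s = f s) ∧
          Set.range g ⊆ convexHull ℝ (closure (Set.range f))) ∧
    (∀ B : Set X, IsRelativelyCompact B ↔ TotallyBounded B) :=
  ⟨⟨fun h f hf => h.exists_extension_convexHull hS f hf,
    IsCStarEmbedded.of_exists_extension_convexHull⟩, isRelativelyCompact_iff_totallyBounded⟩
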